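/- Let $p$ be a prime, $r\ge 1$, and let $S_1,\dots,S_N$ be a sequence over $\mathbb Z_{p^r}$. Let $M\subseteq \mathbb Z_{p^r}[x]^2$ be the row space of $$\begin{bmatrix}x^{N+1}&0\\-(S_Nx^N+\dots+S_1x)&1\end{bmatrix}.$$ Order the monomials $x^\alpha e_i$ ($\alpha\ge 0$, $i\in\{1,2\}$) of $\mathbb Z_{p^r}[x]^2$ by $x^\alpha e_i<x^\beta e_j$ iff $\alpha<\beta$, or $\alpha=\beta$ and $i<j$, and let $\mathrm{lm}(f)$ be the largest monomial occurring in $f\neq 0$ with nonzero coefficient. Let $\mathcal A_p[x]$ be the set of polynomials with coefficients in $\{0,1,\dots,p-1\}\subset\mathbb Z_{p^r}$; a $p$-linear combination of vectors $v_1,\dots,v_n$ is a sum $\sum_i a_iv_i$ with all $a_i\in\mathcal A_p[x]$. Consider the following algorithm. A trajectory assigns a value to each time $t\in\{\dots,-2,-1,0\}$, $\sigma$ is the forward shift, $(\sigma w)(t)=w(t-1)$, and $\mathbf b$ is the trajectory $(\dots,\binom00,\binom10,\binom0{S_1},\dots,\binom0{S_N})$. Put $\mathbf b_k=\sigma^{N-k}\mathbf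 b$. Let $R^0$ be the $2r\times 2$ matrix with rows $(x,0),(px,0),\dots,(p^{r-1}x,0),(0,1),(0,p),\dots,(0,p^{r-1})$. For $k=1,\dots,N$, given $R=R^{k-1}$ with rows $v_1,\dots,v_{2r}$: * let $\Delta=(\Delta_1,\dots,\Delta_{2r})^T$ be the value at time $0$ of $R(\sigma)\mathbf b_k$; for $\Delta_i\ne0$ write $\Delta_i=\theta_ip^{\ell_i-1}$ with $\theta_i$ a unit and $\ell_i\in\{1,\dots,r\}$ (any choice of the units is allowed); * let $\mathcal P_0=\{i:\Delta_i=0\}$ and $\mathcal P_j=\{i:\Delta_i\neq 0,\ \ell_i=j\}$ for $j=1,\dots,r$, and let $i^\star_j$ be the largest index $i\in\mathcal P_j$ for which $\mathrm{lm}(v_i)$ is minimal; * put $R^k=E^kR^{k-1}$, where, with $e_1,\dots,e_{2r}$ the unit row vectors of length $2r$, $$E^k=\sum_{i\in\mathcal P_0}e_i^Te_i+\sum_{j=1}^r\Big[\tfrac{x}{\theta_{i^\star_j}}e_j^Te_{i^\star_j}+e_{i^\star_j}^T(-\theta_{i^\star_j}e_j+\theta_je_{i^\star_j})+\sum_{i\in\mathcal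 P_j\setminus\{j,i^\star_j\}}e_i^T(-\theta_ie_{i^\star_j}+\theta_{i^\star_j}e_i)\Big].$$ The output is $R=R^N$. Then every step of the algorithm can be carried out (whatever units were chosen before), and for every output $R$, with rows $v_1,\dots,v_{2r}$: 1. $\{v_1,\dots,v_{2r}\}$ is a $p$-basis of $M$, that is, for a suitable ordering $(w_1,\dots,w_{2r})$ of the rows: $pw_{2r}=0$ and each $pw_i$ with $i<2r$ is a $p$-linear combination of $w_{i+1},\dots,w_{2r}$; the set of all $p$-linear combinations of $w_1,\dots,w_{2r}$ is $M$; and $\sum_i a_iw_i=0$ with all $a_i\in\mathcal A_p[x]$ forces all $a_i=0$. 2. $\{v_1,\dots,v_{2r}\}$ has the $p$-Predictable Leading Monomial property: for every nonzero $f=\sum_i a_iv_i$ with all $a_i\in\mathcal A_p[x]$ one has $\mathrm{lm}(f)=\max\{\mathrm{lm}(a_iv_i): a_i\neq0\}$. -/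

import Mathlib

open Polynomial

namespace PRing

noncomputable section

/-! ### Polynomial row vectors and the term-over-position ordering -/

/-- The finite ring of integers modulo `p ^ r`. -/
abbrev Zpr (p r : ℕ) : Type := ZMod (p ^ r)

/-- Polynomial row vectors of length `q` over the integers modulo `p ^ r`. -/
abbrev PVec (p r q : ℕ) : Type := Fin q → (Zpr p r)[X]

/-- The monomials `x ^ α * e_i` that occur in `f` with a nonzero coefficient. The monomial
`x ^ α * e_i` is the pair `(α, i)`, and the lexicographic order on such pairs is the
term-over-position ordering: `(α, i) < (β, j)` iff `α < β`, or `α = β` and `i < j`. -/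
def monomials {p r q : ℕ} (f : PVec p r q) : Finset (ℕ ×ₗ Fin q) :=
  Finset.univ.biUnion fun i => (f i).support.image fun α => toLex (α, i)

/-- The leading monomial of `f` for the term-over-position ordering (`⊥` exactly for `f = 0`). -/
def lm {p r q : ℕ} (f : PVec p r q) : WithBot (ℕ ×ₗ Fin q) :=
  (monomials f).max

/-! ### `p`-linear combinations, `p`-bases and the `p`-PLM property -/

/-- `a` is a polynomial whose coefficients are digits, that is, lie in `{0, 1, ..., p - 1}`. -/
def IsDigitPoly {p r : ℕ} (a : (Zpr p r)[X]) : Prop :=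
  ∀ n, (a.coeff n).val < p

/-- The set of all `p`-linear combinations of the family `v`. -/
def pSpan {p r q : ℕ} {ι : Type} [Fintype ι] (v : ι → PVec p r q) : Set (PVec p r q) :=
  {f | ∃ a : ι → (Zpr p r)[X], (∀ i, IsDigitPoly (a i)) ∧ f = ∑ i, a i • v i}

/-- `(v_1, ..., v_n)` is a `p`-generator sequence: each `p * v_i` is a `p`-linear combination of
the later vectors. For the last vector there are no later ones, so this says `p * v_n = 0`. -/
def IsPGenSeq {p r q n : ℕ} (v : Fin n → PVec p r q) : Prop :=
  ∀ i : Fin n, p • v i ∈ pSpan (fun j : {j : Fin n // i < j} => v j)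

/-- Only the trivial `p`-linear combination of the `v_i` is zero. -/
def PLinIndep {p r q n : ℕ} (v : Fin n → PVec p r q) : Prop :=
  ∀ a : Fin n → (Zpr p r)[X], (∀ i, IsDigitPoly (a i)) → ∑ i, a i • v i = 0 → ∀ i, a i = 0

/-- The ordered sequence `(v_1, ..., v_n)` is a `p`-basis of the module `M`. -/
structure IsPBasis {p r q n : ℕ} (v : Fin n → PVec p r q)
    (M : Submodule (Zpr p r)[X] (PVec p r q)) : Prop where
  genSeq : IsPGenSeq v
  span_eq : pSpan v = (M : Set (PVec p r q))
  indep : PLinIndep v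

/-- The `p`-predictable leading monomial property of `{v_1, ..., v_n}`: for every way of writing
a nonzero `f` as a `p`-linear combination of the `v_i`, the leading monomial of `f` is the
maximum of the leading monomials of the `a_i * v_i` with `a_i ≠ 0`. -/
def HasPPLM {p r q n : ℕ} (v : Fin n → PVec p r q) : Prop :=
  ∀ (f : PVec p r q) (a : Fin n → (Zpr p r)[X]), f ≠ 0 → (∀ i, IsDigitPoly (a i)) →
    f = ∑ i, a i • v i →
    lm f = (Finset.univ.filter fun i => a i ≠ 0).sup fun i => lm (a i • v i)

/-! ### The module attached to a sequence -/

/-- The `2 × 2` matrix with rows `(x ^ (N + 1), 0)` and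
`(-(S_N x ^ N + ... + S_1 x), 1)`. -/
def seqMatrix {p r : ℕ} (N : ℕ) (S : ℕ → Zpr p r) : Matrix (Fin 2) (Fin 2) (Zpr p r)[X] :=
  !![X ^ (N + 1), 0; -(∑ k ∈ Finset.Icc 1 N, C (S k) * X ^ k), 1]

/-- The row space of `seqMatrix N S`. -/
def seqModule {p r : ℕ} (N : ℕ) (S : ℕ → Zpr p r) : Submodule (Zpr p r)[X] (PVec p r 2) :=
  Submodule.span (Zpr p r)[X] (Set.range (seqMatrix N S).row)

/-! ### Trajectories -/

/-- The forward shift `σ` on scalar trajectories over the times `..., -2, -1, 0`. A trajectory is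
written as `w : ℕ → Zpr p r`, with `w n` the value at time `-n`; the value of `σ w` at time `t`
is the value of `w` at time `t - 1`. -/
def shift (p r : ℕ) : (ℕ → Zpr p r) →ₗ[Zpr p r] (ℕ → Zpr p r) where
  toFun w n := w (n + 1)
  map_add' _ _ := rfl
  map_smul' _ _ := rfl

/-- The trajectory `(..., (0, 0), (1, 0), (0, S_1), ..., (0, S_N))`, by components. -/
def baseTraj {p r : ℕ} (N : ℕ) (S : ℕ → Zpr p r) : Fin 2 → ℕ → Zpr p r :=
  ![fun n => if n = N then 1 else 0, fun n => if n < N then S (N - n) else 0]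

/-- The trajectory `b_k = σ ^ (N - k) b`. -/
def stepTraj {p r : ℕ} (N : ℕ) (S : ℕ → Zpr p r) (k : ℕ) : Fin 2 → ℕ → Zpr p r :=
  fun c => (shift p r ^ (N - k)) (baseTraj N S c)

/-- The action `v(σ) w` of a polynomial row vector on a trajectory with two components. -/
def rowAct {p r : ℕ} (v : PVec p r 2) (w : Fin 2 → ℕ → Zpr p r) : ℕ → Zpr p r :=
  ∑ c, aeval (shift p r) (v c) (w c)

/-! ### The algorithm -/

/-- `2r × 2` polynomial matrices; the rows with (zero-based) index below `r` are the upper ones. -/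
abbrev State (p r : ℕ) : Type := Matrix (Fin (2 * r)) (Fin 2) (Zpr p r)[X]

/-- An index `j` in `{1, ..., r}` seen as an index of one of the `2r` rows. -/
def up {r : ℕ} (j : Fin r) : Fin (2 * r) := Fin.castLE (by omega) j

/-- The initial matrix, with rows `(x, 0), (p x, 0), ..., (p ^ (r - 1) x, 0)` followed by
`(0, 1), (0, p), ..., (0, p ^ (r - 1))`. -/
def initState (p r : ℕ) : State p r :=
  Matrix.of fun i => if (i : ℕ) < r then ![C ((p : Zpr p r) ^ (i : ℕ)) * X, 0]
    else ![0, C ((p : Zpr p r) ^ ((i : ℕ) - r))]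

/-- The vector `Δ ^ k` of last entries of the error trajectory `R(σ) b_k`. -/
def discrepancy {p r : ℕ} (N : ℕ) (S : ℕ → Zpr p r) (k : ℕ) (R : State p r) :
    Fin (2 * r) → Zpr p r :=
  fun i => rowAct (R i) (stepTraj N S k) 0

/-- The index set `P_j`: the rows with nonzero discrepancy, of level `j`. The level `ℓ i` is
zero-based: `Δ_i = θ_i * p ^ (ℓ i)`. -/
def levelSet {p r : ℕ} (Δ : Fin (2 * r) → Zpr p r) (ℓ : Fin (2 * r) → Fin r) (j : Fin r) :
    Finset (Fin (2 * r)) :=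
  Finset.univ.filter fun i => Δ i ≠ 0 ∧ ℓ i = j

/-- `i` is the largest index in `P` among those for which the leading monomial of row `i` of `R`
is minimal over `P`. -/
def IsPivot {p r : ℕ} (R : State p r) (P : Finset (Fin (2 * r))) (i : Fin (2 * r)) : Prop :=
  i ∈ P ∧ (∀ i' ∈ P, lm (R i) ≤ lm (R i')) ∧ ∀ i' ∈ P, lm (R i') = lm (R i) → i' ≤ i

/-- The update matrix `E ^ k`. Here `Matrix.single i j a` is the matrix `a e_i^T e_j`. -/
def updateMatrix {p r : ℕ} (Δ : Fin (2 * r) → Zpr p r) (θ : Fin (2 * r) → (Zpr p r)ˣ)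
    (ℓ : Fin (2 * r) → Fin r) (s : Fin r → Fin (2 * r)) :
    Matrix (Fin (2 * r)) (Fin (2 * r)) (Zpr p r)[X] :=
  (∑ i ∈ Finset.univ.filter fun i => Δ i = 0, Matrix.single i i 1) +
  ∑ j : Fin r,
    (Matrix.single (up j) (s j) (C (((θ (s j))⁻¹ : (Zpr p r)ˣ) : Zpr p r) * X) +
      (Matrix.single (s j) (up j) (-C (θ (s j) : Zpr p r)) +
        Matrix.single (s j) (s j) (C (θ (up j) : Zpr p r))) +
      ∑ i ∈ levelSet Δ ℓ j \ {up j, s j},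
        (Matrix.single i (s j) (-C (θ i : Zpr p r)) +
          Matrix.single i i (C (θ (s j) : Zpr p r))))

/-- `R'` is a result of processing `R` with discrepancies `Δ`: for some choice of units `θ_i` and
levels `ℓ_i` with `Δ_i = θ_i p ^ ℓ_i` (where `Δ_i ≠ 0`), and with the pivots `s j` so
determined, `R'` is the update matrix times `R`. -/
def IsUpdate {p r : ℕ} (Δ : Fin (2 * r) → Zpr p r) (R R' : State p r) : Prop :=
  ∃ (θ : Fin (2 * r) → (Zpr p r)ˣ) (ℓ : Fin (2 * r) → Fin r) (s : Fin r → Fin (2 * r)),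
    (∀ i, Δ i ≠ 0 → Δ i = (θ i : Zpr p r) * (p : Zpr p r) ^ (ℓ i : ℕ)) ∧
    (∀ j, IsPivot R (levelSet Δ ℓ j) (s j)) ∧
    R' = updateMatrix Δ θ ℓ s * R

/-- `IsState N S k R`: the matrix `R` can be obtained as `R ^ k` when the algorithm is run on
`S_1, ..., S_N`. -/
inductive IsState {p r : ℕ} (N : ℕ) (S : ℕ → Zpr p r) : ℕ → State p r → Prop
  | init : IsState N S 0 (initState p r)
  | step {k : ℕ} {R R' : State p r} : k < N → IsState N S k R →
      IsUpdate (discrepancy N S (k + 1) R) R R' → IsState N S (k + 1) R'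

/-- `R` is an output of the algorithm run on `S_1, ..., S_N`. -/
def IsOutput {p r : ℕ} (N : ℕ) (S : ℕ → Zpr p r) (R : State p r) : Prop :=
  IsState N S N R

end

end PRing

/-! Attach to a nonzero vector its lead: the leading monomial together with the `p`-adic valuation
of the leading coefficient. The type of a lead is the pair (position, valuation). The central notion
is `IsLeadBasis`: vectors of `M` with pairwise distinct types, such that every lead in `M` has the
type of one of them and at least its degree.

Such a family has both desired properties. Nonzero digits are units, so multiplying by a digit
polynomial keeps the type; at the top monomial of a `p`-linear combination the least valuation then
occurs only once, and nothing cancels (`IsLeadBasis.lead_sum`). This gives independence and the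
`p`-PLM property. Conversely, subtracting a digit multiple of `x ^ n • v i` lowers the monomial or
raises the valuation, so division terminates (`IsLeadBasis.exists_combination`). Since `p • v i`
ranks below `v i`, ordering by decreasing rank gives a `p`-generator sequence.

For the algorithm, let `M_k` consist of the `f` with `x ^ (k + 1)` dividing `f_1 + f_2 (S_N x ^ N +
... + S_1 x)`. Then `M_N` is the given module, the discrepancy at step `k + 1` is the coefficient of
`x ^ (k + 1)` in this form, and `M_(k+1)` is its kernel in `M_k`. The invariant says that the rows
of `R ^ k` are a lead basis of `M_k` and that row `up j` has discrepancy `p ^ j`, so every level is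
inhabited. In each level the pivot has strictly the smallest leading monomial
(`IsLeadBasis.pivot_lt`); correcting the other rows by it preserves their leads, while the pivot is
multiplied by `x`. The new rows still cover all leads because a lead of `M_(k+1)` equal to that of
the pivot would yield a row of the same level below the pivot (`IsLeadBasis.exists_hasVal_coeff`).
-/

namespace PRing

/-! ### Valuations in `ZMod (p ^ r)` -/

/-- The `p`-adic valuation of `a` is exactly `m` (in particular `m < r`). -/
def HasVal {p r : ℕ} (a : Zpr p r) (m : ℕ) : Prop :=
  (p : Zpr p r) ^ m ∣ a ∧ ¬ (p : Zpr p r) ^ (m + 1) ∣ a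

section Valuation

variable {p r : ℕ}

lemma natCast_pow_eq_zero : (p : Zpr p r) ^ r = 0 := by
  have := ZMod.natCast_self (p ^ r)
  push_cast at this
  exact this

lemma HasVal.lt {a : Zpr p r} {m : ℕ} (h : HasVal a m) : m < r := by
  by_contra hm
  have h0 : (p : Zpr p r) ^ m = 0 := pow_eq_zero_of_le (not_lt.1 hm) natCast_pow_eq_zero
  apply h.2
  have := h.1
  rw [h0, zero_dvd_iff] at this
  simp [this]

lemma HasVal.ne_zero {a : Zpr p r} {m : ℕ} (h : HasVal a m) : a ≠ 0 := by
  rintro rfl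
  exact h.2 (dvd_zero _)

lemma exists_hasVal {a : Zpr p r} (ha : a ≠ 0) : ∃ m, HasVal a m := by
  classical
  have hex : ∃ n, ¬ (p : Zpr p r) ^ n ∣ a :=
    ⟨r, by rwa [natCast_pow_eq_zero, zero_dvd_iff]⟩
  obtain ⟨m, hm⟩ : ∃ m, Nat.find hex = m + 1 :=
    Nat.exists_eq_succ_of_ne_zero fun h => by
      have := Nat.find_spec hex
      rw [h] at this
      simp at this
  refine ⟨m, ?_, hm ▸ Nat.find_spec hex⟩
  by_contra h
  have := Nat.find_min' hex h
  omega

lemma HasVal.unique {a : Zpr p r} {m n : ℕ} (h : HasVal a m) (h' : HasVal a n) : m = n := by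
  rcases lt_trichotomy m n with hl | hl | hl
  · exact absurd ((pow_dvd_pow _ hl).trans h'.1) h.2
  · exact hl
  · exact absurd ((pow_dvd_pow _ hl).trans h.1) h'.2

lemma hasVal_units_mul (u : (Zpr p r)ˣ) {a : Zpr p r} {m : ℕ} :
    HasVal ((u : Zpr p r) * a) m ↔ HasVal a m := by
  simp [HasVal]

lemma HasVal.add_dvd {a b : Zpr p r} {m : ℕ} (ha : HasVal a m)
    (hb : (p : Zpr p r) ^ (m + 1) ∣ b) : HasVal (a + b) m :=
  ⟨dvd_add ha.1 ((pow_dvd_pow _ m.le_succ).trans hb), fun h => ha.2 ((dvd_add_left hb).1 h)⟩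

lemma isUnit_of_not_dvd (hp : p.Prime) {b : Zpr p r} (hb : ¬ (p : Zpr p r) ∣ b) :
    IsUnit b := by
  have : NeZero (p ^ r) := ⟨(pow_pos hp.pos r).ne'⟩
  rw [← ZMod.natCast_zmod_val b, ZMod.isUnit_iff_coprime]
  apply Nat.Coprime.pow_right
  rw [Nat.coprime_comm, hp.coprime_iff_not_dvd]
  rintro ⟨c, hc⟩
  apply hb
  rw [← ZMod.natCast_zmod_val b, hc]
  simp

lemma HasVal.exists_unit (hp : p.Prime) {a : Zpr p r} {m : ℕ} (h : HasVal a m) :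
    ∃ u : (Zpr p r)ˣ, a = u * (p : Zpr p r) ^ m := by
  obtain ⟨b, rfl⟩ := h.1
  have hb : ¬ (p : Zpr p r) ∣ b := fun hb => h.2 (by
    rw [pow_succ]
    exact mul_dvd_mul_left _ hb)
  obtain ⟨u, rfl⟩ := isUnit_of_not_dvd hp hb
  exact ⟨u, mul_comm _ _⟩

lemma natCast_pow_ne_zero (hp : p.Prime) {m : ℕ} (hm : m < r) : (p : Zpr p r) ^ m ≠ 0 := by
  intro h
  have h' : ((p ^ m : ℕ) : Zpr p r) = 0 := by simpa using h
  rw [ZMod.natCast_eq_zero_iff, Nat.pow_dvd_pow_iff_le_right hp.one_lt] at h'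
  omega

lemma hasVal_pow (hp : p.Prime) {m : ℕ} (hm : m < r) : HasVal ((p : Zpr p r) ^ m) m := by
  refine ⟨dvd_rfl, fun h => ?_⟩
  -- Scaling `p ^ (m + 1) ∣ p ^ m` up gives `p ^ r ∣ p ^ (r - 1)`, that is, `p ^ (r - 1) = 0`.
  apply natCast_pow_ne_zero hp (show r - 1 < r by omega)
  have h2 : (p : Zpr p r) ^ r ∣ (p : Zpr p r) ^ (r - 1) := by
    have := mul_dvd_mul_left ((p : Zpr p r) ^ (r - 1 - m)) h
    rw [← pow_add, ← pow_add] at this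
    convert this using 2 <;> omega
  rwa [natCast_pow_eq_zero, zero_dvd_iff] at h2

/-- Two elements of equal valuation differ by a unit. -/
lemma HasVal.exists_eq_units_mul (hp : p.Prime) {a b : Zpr p r} {m : ℕ} (ha : HasVal a m)
    (hb : HasVal b m) : ∃ u : (Zpr p r)ˣ, a = u * b := by
  obtain ⟨u, hu⟩ := ha.exists_unit hp
  obtain ⟨w, hw⟩ := hb.exists_unit hp
  exact ⟨u * w⁻¹, by rw [hu, hw]; simp [mul_assoc]⟩

/-- Every element is congruent to a digit modulo `p`. -/
lemma exists_digit (hp : p.Prime) (hr : 1 ≤ r) (u : Zpr p r) :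
    ∃ t : Zpr p r, t.val < p ∧ (p : Zpr p r) ∣ u - t := by
  have : NeZero (p ^ r) := ⟨(pow_pos hp.pos r).ne'⟩
  have hle : p ≤ p ^ r := Nat.le_self_pow (by omega) p
  have hlt := Nat.mod_lt u.val hp.pos
  refine ⟨((u.val % p : ℕ) : Zpr p r), ?_, ?_⟩
  · rwa [ZMod.val_natCast, Nat.mod_eq_of_lt (hlt.trans_le hle)]
  · refine ⟨((u.val / p : ℕ) : Zpr p r), ?_⟩
    rw [sub_eq_iff_eq_add, ← Nat.cast_mul, ← Nat.cast_add, Nat.div_add_mod,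
      ZMod.natCast_zmod_val]

lemma isUnit_of_digit (hp : p.Prime) {t : Zpr p r} (ht : t.val < p) (h0 : t ≠ 0) :
    IsUnit t := by
  have : NeZero (p ^ r) := ⟨(pow_pos hp.pos r).ne'⟩
  rw [← ZMod.natCast_zmod_val t, ZMod.isUnit_iff_coprime]
  apply Nat.Coprime.pow_right
  rw [Nat.coprime_comm, hp.coprime_iff_not_dvd]
  intro h
  exact absurd (Nat.le_of_dvd (Nat.pos_of_ne_zero (by simpa using h0)) h) (by omega)

end Valuation

/-! ### Leading monomials with valuation of the leading coefficient -/

section Lead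

variable {p r q : ℕ}

/-- The coefficient of `f` at the monomial `μ`. -/
def coef (f : PVec p r q) (μ : ℕ ×ₗ Fin q) : Zpr p r :=
  (f (ofLex μ).2).coeff (ofLex μ).1

@[simp] lemma coef_zero (μ : ℕ ×ₗ Fin q) : coef (0 : PVec p r q) μ = 0 := by
  simp [coef]

@[simp] lemma coef_add (f g : PVec p r q) (μ : ℕ ×ₗ Fin q) :
    coef (f + g) μ = coef f μ + coef g μ := by
  simp [coef]

@[simp] lemma coef_sub (f g : PVec p r q) (μ : ℕ ×ₗ Fin q) :
    coef (f - g) μ = coef f μ - coef g μ := by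
  simp [coef]

@[simp] lemma coef_C_smul (a : Zpr p r) (f : PVec p r q) (μ : ℕ ×ₗ Fin q) :
    coef (C a • f) μ = a * coef f μ := by
  simp [coef]

lemma coef_sum {ι : Type} (s : Finset ι) (f : ι → PVec p r q) (μ : ℕ ×ₗ Fin q) :
    coef (∑ i ∈ s, f i) μ = ∑ i ∈ s, coef (f i) μ := by
  simp [coef]

lemma ext_coef {f g : PVec p r q} (h : ∀ μ, coef f μ = coef g μ) : f = g := by
  ext c n
  exact h (toLex (n, c))

lemma mem_monomials {f : PVec p r q} {μ : ℕ ×ₗ Fin q} :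
    μ ∈ monomials f ↔ coef f μ ≠ 0 := by
  simp only [monomials, Finset.mem_biUnion, Finset.mem_univ, true_and, Finset.mem_image,
    mem_support_iff, coef]
  constructor
  · rintro ⟨i, α, h, rfl⟩
    exact h
  · intro h
    exact ⟨_, _, h, rfl⟩

/-- The leading monomial of `f` is `μ`, with a leading coefficient of valuation `m`. -/
def IsLead (f : PVec p r q) (μ : ℕ ×ₗ Fin q) (m : ℕ) : Prop :=
  HasVal (coef f μ) m ∧ ∀ ν, μ < ν → coef f ν = 0

lemma IsLead.lm_eq {f : PVec p r q} {μ : ℕ ×ₗ Fin q} {m : ℕ} (h : IsLead f μ m) :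
    lm f = μ := by
  apply le_antisymm
  · apply Finset.max_le
    intro ν hν
    rw [mem_monomials] at hν
    exact WithBot.coe_le_coe.2 (not_lt.1 fun hlt => hν (h.2 ν hlt))
  · exact Finset.le_max (mem_monomials.2 h.1.ne_zero)

lemma IsLead.ne_zero {f : PVec p r q} {μ : ℕ ×ₗ Fin q} {m : ℕ} (h : IsLead f μ m) : f ≠ 0 := by
  rintro rfl
  exact h.1.ne_zero (coef_zero μ)

lemma exists_isLead {f : PVec p r q} (hf : f ≠ 0) : ∃ μ m, IsLead f μ m := by
  have hne : (monomials f).Nonempty := by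
    by_contra h
    rw [Finset.not_nonempty_iff_eq_empty] at h
    apply hf
    apply ext_coef
    intro μ
    by_contra hμ
    have := mem_monomials.2 (by simpa using hμ)
    simp [h] at this
  obtain ⟨m, hm⟩ := exists_hasVal (mem_monomials.1 (Finset.max'_mem _ hne))
  refine ⟨_, m, hm, fun ν hν => ?_⟩
  by_contra h
  exact absurd (Finset.le_max' _ _ (mem_monomials.2 h)) (not_le.2 hν)

lemma IsLead.le_of_vanish {f : PVec p r q} {μ μ' : ℕ ×ₗ Fin q} {m : ℕ} (h : IsLead f μ' m)
    (hf : ∀ ν, μ < ν → coef f ν = 0) : μ' ≤ μ :=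
  not_lt.1 fun hlt => h.1.ne_zero (hf _ hlt)

lemma IsLead.lt_of_vanish {f : PVec p r q} {μ μ' : ℕ ×ₗ Fin q} {m : ℕ} (h : IsLead f μ' m)
    (hf : ∀ ν, μ ≤ ν → coef f ν = 0) : μ' < μ :=
  not_le.1 fun hlt => h.1.ne_zero (hf _ hlt)

lemma toLex_lt_iff {d e : ℕ} {c c' : Fin q} :
    (toLex (d, c) : ℕ ×ₗ Fin q) < toLex (e, c') ↔ d < e ∨ d = e ∧ c < c' :=
  Prod.Lex.toLex_lt_toLex

/-- Multiplication by a polynomial with invertible leading coefficient shifts the lead. -/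
lemma IsLead.smul {v : PVec p r q} {d : ℕ} {c : Fin q} {m : ℕ}
    (h : IsLead v (toLex (d, c)) m) {a : (Zpr p r)[X]} (ha : IsUnit a.leadingCoeff) :
    IsLead (a • v) (toLex (a.natDegree + d, c)) m := by
  have hdeg : ∀ c', (v c').natDegree ≤ d := fun c' =>
    natDegree_le_iff_coeff_eq_zero.2 fun n hn =>
      h.2 (toLex (n, c')) (toLex_lt_iff.2 (Or.inl hn))
  have htop : ∀ c', (a * v c').coeff (a.natDegree + d) = a.leadingCoeff * (v c').coeff d :=
    fun c' => coeff_mul_add_eq_of_natDegree_le le_rfl (hdeg c')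
  obtain ⟨u, hu⟩ := ha
  constructor
  · change HasVal ((a * v c).coeff (a.natDegree + d)) m
    rw [htop, ← hu, hasVal_units_mul]
    exact h.1
  · intro ν hν
    obtain ⟨⟨n, c'⟩, rfl⟩ := toLex.surjective ν
    change (a * v c').coeff n = 0
    rcases toLex_lt_iff.1 hν with hlt | ⟨rfl, hlt⟩
    · exact coeff_eq_zero_of_natDegree_lt
        ((natDegree_mul_le_of_le le_rfl (hdeg c')).trans_lt hlt)
    · rw [htop]
      have : (v c').coeff d = 0 := h.2 (toLex (d, c')) (toLex_lt_iff.2 (Or.inr ⟨rfl, hlt⟩))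
      rw [this, mul_zero]

/-- Adding a vector with a smaller leading monomial preserves the lead. -/
lemma IsLead.add_of_lt {v w : PVec p r q} {μ μ' : ℕ ×ₗ Fin q} {m m' : ℕ} (hv : IsLead v μ m)
    (hw : IsLead w μ' m') (hlt : μ' < μ) (u : (Zpr p r)ˣ) (b : Zpr p r) :
    IsLead (C (u : Zpr p r) • v + C b • w) μ m := by
  constructor
  · rw [coef_add, coef_C_smul, coef_C_smul, hw.2 _ hlt, mul_zero, add_zero, hasVal_units_mul]
    exact hv.1
  · intro ν hν
    simp [hv.2 ν hν, hw.2 ν (hlt.trans hν)]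

/-- Vectors with the same lead cancel, up to a unit, to something with a smaller lead. -/
lemma IsLead.exists_cancel (hp : p.Prime) {v w : PVec p r q} {μ : ℕ ×ₗ Fin q} {m : ℕ}
    (hv : IsLead v μ m) (hw : IsLead w μ m) :
    ∃ u : (Zpr p r)ˣ, ∀ ν, μ ≤ ν → coef (w - C (u : Zpr p r) • v) ν = 0 := by
  obtain ⟨u, hu⟩ := hw.1.exists_eq_units_mul hp hv.1
  refine ⟨u, fun ν hν => ?_⟩
  rcases hν.eq_or_lt with rfl | hlt
  · simp [hu]
  · simp [hv.2 ν hlt, hw.2 ν hlt]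

lemma IsDigitPoly.isUnit_leadingCoeff (hp : p.Prime) {a : (Zpr p r)[X]} (ha : IsDigitPoly a)
    (h0 : a ≠ 0) : IsUnit a.leadingCoeff :=
  isUnit_of_digit hp (ha _) (leadingCoeff_ne_zero.2 h0)

end Lead

/-! ### Families that represent all leads of a module -/

section LeadBasis

variable {p r q : ℕ} {ι : Type}

/-- The vectors `v i` lie in `M`, have leading degree `d i`, and the pairs `t i` of leading position
and valuation of the leading coefficient are distinct; every lead of an element of `M` is a
multiple of the lead of some `v i` with the same position and valuation. -/
structure IsLeadBasis (M : Submodule (Zpr p r)[X] (PVec p r q)) (v : ι → PVec p r q)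
    (d : ι → ℕ) (t : ι → Fin q × ℕ) : Prop where
  mem : ∀ i, v i ∈ M
  lead : ∀ i, IsLead (v i) (toLex (d i, (t i).1)) (t i).2
  inj : Function.Injective t
  cover : ∀ f ∈ M, ∀ e c m, IsLead f (toLex (e, c)) m → ∃ i, t i = (c, m) ∧ d i ≤ e

/-- Leads ordered by the monomial and then by decreasing valuation. -/
def leadRank (r : ℕ) (μ : ℕ ×ₗ Fin q) (m : ℕ) : (ℕ ×ₗ Fin q) ×ₗ ℕ :=
  toLex (μ, r - m)

lemma leadRank_lt_iff {μ μ' : ℕ ×ₗ Fin q} {m m' : ℕ} :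
    leadRank r μ m < leadRank r μ' m' ↔ μ < μ' ∨ μ = μ' ∧ r - m < r - m' :=
  Prod.Lex.toLex_lt_toLex

lemma leadRank_mono_deg {d e : ℕ} (h : d ≤ e) (c : Fin q) (m : ℕ) :
    leadRank r (toLex (d, c)) m ≤ leadRank r (toLex (e, c)) m := by
  rcases h.eq_or_lt with rfl | h
  · exact le_rfl
  · exact (leadRank_lt_iff.2 (Or.inl (toLex_lt_iff.2 (Or.inl h)))).le

/-- The progress measure of division: either the coefficient at `μ` vanishes and the monomial drops,
or it survives with a larger valuation. -/
lemma IsLead.leadRank_lt {f : PVec p r q} {μ μ' : ℕ ×ₗ Fin q} {m m' : ℕ} (hf : IsLead f μ' m')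
    (habove : ∀ ν, μ < ν → coef f ν = 0) (hdvd : (p : Zpr p r) ^ (m + 1) ∣ coef f μ) :
    leadRank r μ' m' < leadRank r μ m := by
  rw [leadRank_lt_iff]
  rcases (hf.le_of_vanish habove).lt_or_eq with h | rfl
  · exact Or.inl h
  · refine Or.inr ⟨rfl, ?_⟩
    have hlt : m < m' := by
      by_contra hle
      exact hf.1.2 ((pow_dvd_pow _ (by omega)).trans hdvd)
    have := hf.1.lt
    omega

/-- The leading coefficients differ by a unit, of which only the residue digit modulo `p` may be
used. The lead need not cancel, but what remains of its coefficient gains a factor `p`. -/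
lemma IsLeadBasis.exists_reduction (hp : p.Prime) (hr : 1 ≤ r)
    {M : Submodule (Zpr p r)[X] (PVec p r q)} {v : ι → PVec p r q} {d : ι → ℕ}
    {t : ι → Fin q × ℕ} (h : IsLeadBasis M v d t) {f : PVec p r q} (hf : f ∈ M) {e : ℕ}
    {c : Fin q} {m : ℕ} (hl : IsLead f (toLex (e, c)) m) :
    ∃ i, ∃ x : Zpr p r, x.val < p ∧ t i = (c, m) ∧ d i ≤ e ∧
      ∀ μ' m', IsLead (f - monomial (e - d i) x • v i) μ' m' →
        leadRank r μ' m' < leadRank r (toLex (e, c)) m := by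
  obtain ⟨i, hi, hd⟩ := h.cover f hf e c m hl
  have hv := h.lead i
  rw [hi] at hv
  have : NeZero (p ^ r) := ⟨(pow_pos hp.pos r).ne'⟩
  have : Fact (1 < p ^ r) := ⟨Nat.one_lt_pow (by omega) hp.one_lt⟩
  have hs : IsLead ((X ^ (e - d i) : (Zpr p r)[X]) • v i) (toLex (e, c)) m := by
    have := hv.smul (a := X ^ (e - d i)) (by simp)
    rwa [natDegree_X_pow, Nat.sub_add_cancel hd] at this
  obtain ⟨u, hu⟩ := hl.1.exists_eq_units_mul hp hs.1
  obtain ⟨x, hx, hux⟩ := exists_digit hp hr (u : Zpr p r)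
  refine ⟨i, x, hx, hi, hd, fun μ' m' hl' => hl'.leadRank_lt (fun ν hν => ?_) ?_⟩
  · rw [← C_mul_X_pow_eq_monomial, mul_smul, coef_sub, coef_C_smul, hl.2 ν hν, hs.2 ν hν]
    simp
  · rw [← C_mul_X_pow_eq_monomial, mul_smul, coef_sub, coef_C_smul, hu, ← sub_mul, pow_succ']
    exact mul_dvd_mul hux hs.1.1

variable [Fintype ι]

/-- Every element of `M` is a `p`-linear combination without cancellation of leads. -/
lemma IsLeadBasis.exists_combination (hp : p.Prime) (hr : 1 ≤ r)
    {M : Submodule (Zpr p r)[X] (PVec p r q)} {v : ι → PVec p r q} {d : ι → ℕ}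
    {t : ι → Fin q × ℕ} (h : IsLeadBasis M v d t) (ρ : (ℕ ×ₗ Fin q) ×ₗ ℕ) :
    ∀ f ∈ M, ∀ μ m, IsLead f μ m → leadRank r μ m = ρ →
      ∃ a : ι → (Zpr p r)[X], (∀ i, IsDigitPoly (a i)) ∧ f = ∑ i, a i • v i ∧
        ∀ i n, (a i).coeff n ≠ 0 → leadRank r (toLex (n + d i, (t i).1)) (t i).2 ≤ ρ := by
  classical
  induction ρ using WellFoundedLT.induction with
  | ind ρ ih =>
  rintro f hf μ m hl rfl
  obtain ⟨⟨e, c⟩, rfl⟩ := toLex.surjective μ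
  obtain ⟨i, x, hx, hi, hd, hlt⟩ := h.exists_reduction hp hr hf hl
  obtain ⟨a, had, haf, har⟩ : ∃ a : ι → (Zpr p r)[X], (∀ i, IsDigitPoly (a i)) ∧
      f - monomial (e - d i) x • v i = ∑ i, a i • v i ∧ ∀ i n, (a i).coeff n ≠ 0 →
        leadRank r (toLex (n + d i, (t i).1)) (t i).2 < leadRank r (toLex (e, c)) m := by
    by_cases h0 : f - monomial (e - d i) x • v i = 0
    · exact ⟨0, fun i n => by simpa using hp.pos, by simp [h0], by simp⟩
    · obtain ⟨μ', m', hl'⟩ := exists_isLead h0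
      obtain ⟨a, h1, h2, h3⟩ := ih _ (hlt _ _ hl') _
        (M.sub_mem hf (M.smul_mem _ (h.mem i))) _ _ hl' rfl
      exact ⟨a, h1, h2, fun i n hn => (h3 i n hn).trans_lt (hlt _ _ hl')⟩
  -- The remainder uses only strictly smaller ranks, so this slot is free and inserting the digit
  -- `x` causes no carry.
  have ha0 : (a i).coeff (e - d i) = 0 := by
    by_contra hne
    have := har i _ hne
    rw [Nat.sub_add_cancel hd, hi] at this
    exact lt_irrefl _ this
  refine ⟨a + Pi.single i (monomial (e - d i) x), fun j n => ?_, ?_, fun j n hn => ?_⟩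
  · rcases eq_or_ne j i with rfl | hj
    · by_cases hn : e - d j = n
      · subst hn
        simpa [ha0] using hx
      · simpa [coeff_monomial, hn] using had j n
    · simpa [hj] using had j n
  · simp only [Pi.add_apply, add_smul, Finset.sum_add_distrib, ← haf]
    rw [Finset.sum_eq_single i]
    · simp
    · intro j _ hj
      simp [hj]
    · simp
  · by_cases hj : (a j).coeff n = 0
    · rcases eq_or_ne j i with rfl | hji
      · have hn' : e - d j = n := by
          by_contra hne
          simp [hj, coeff_monomial, hne] at hn
        rw [← hn', Nat.sub_add_cancel hd, hi]
      · simp [hj, hji] at hn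
    · exact (har j n hj).le

lemma IsLeadBasis.pSpan_eq (hp : p.Prime) (hr : 1 ≤ r)
    {M : Submodule (Zpr p r)[X] (PVec p r q)} {v : ι → PVec p r q} {d : ι → ℕ}
    {t : ι → Fin q × ℕ} (h : IsLeadBasis M v d t) : pSpan v = (M : Set (PVec p r q)) := by
  ext f
  constructor
  · rintro ⟨a, -, rfl⟩
    exact M.sum_mem fun i _ => M.smul_mem _ (h.mem i)
  · intro hf
    by_cases h0 : f = 0
    · exact ⟨0, fun i n => by simpa using hp.pos, by simp [h0]⟩
    · obtain ⟨μ, m, hl⟩ := exists_isLead h0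
      obtain ⟨a, h1, h2, -⟩ := h.exists_combination hp hr _ f hf μ m hl rfl
      exact ⟨a, h1, h2⟩

/-- Leads do not cancel in `p`-linear combinations. -/
lemma IsLeadBasis.lead_sum (hp : p.Prime)
    {M : Submodule (Zpr p r)[X] (PVec p r q)} {v : ι → PVec p r q} {d : ι → ℕ}
    {t : ι → Fin q × ℕ} (h : IsLeadBasis M v d t) {a : ι → (Zpr p r)[X]}
    (ha : ∀ i, IsDigitPoly (a i)) (hne : ∃ i, a i ≠ 0) :
    ∃ i m, a i ≠ 0 ∧ IsLead (∑ i, a i • v i) (toLex ((a i).natDegree + d i, (t i).1)) m ∧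
      ∀ j, a j ≠ 0 → toLex ((a j).natDegree + d j, (t j).1) ≤
        (toLex ((a i).natDegree + d i, (t i).1) : ℕ ×ₗ Fin q) := by
  classical
  have hl : ∀ j, a j ≠ 0 →
      IsLead (a j • v j) (toLex ((a j).natDegree + d j, (t j).1)) (t j).2 :=
    fun j hj => (h.lead j).smul ((ha j).isUnit_leadingCoeff hp hj)
  -- Maximal rank means the top monomial and, among the terms attaining it, the least valuation;
  -- distinct types make the other valuations there strictly larger.
  obtain ⟨i, hi, hmax⟩ := Finset.exists_max_image (Finset.univ.filter fun i => a i ≠ 0)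
    (fun i => leadRank r (toLex ((a i).natDegree + d i, (t i).1)) (t i).2)
    (by obtain ⟨i, hi⟩ := hne; exact ⟨i, by simpa using hi⟩)
  simp only [Finset.mem_filter, Finset.mem_univ, true_and] at hi hmax
  have hle : ∀ j, a j ≠ 0 → toLex ((a j).natDegree + d j, (t j).1) ≤
      (toLex ((a i).natDegree + d i, (t i).1) : ℕ ×ₗ Fin q) := fun j hj =>
    not_lt.1 fun hlt => not_lt.2 (hmax j hj) (leadRank_lt_iff.2 (Or.inl hlt))
  refine ⟨i, (t i).2, hi, ⟨?_, fun ν hν => ?_⟩, hle⟩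
  · rw [coef_sum, ← Finset.add_sum_erase _ _ (Finset.mem_univ i)]
    refine (hl i hi).1.add_dvd (Finset.dvd_sum fun j hj => ?_)
    rw [Finset.mem_erase] at hj
    by_cases hj0 : a j = 0
    · simp [hj0]
    rcases (hle j hj0).lt_or_eq with hlt | heq
    · rw [(hl j hj0).2 _ hlt]
      exact dvd_zero _
    · have hc : (t j).1 = (t i).1 := congrArg (fun x => (ofLex x).2) heq
      have hm : (t i).2 ≤ (t j).2 := by
        by_contra hm
        refine not_lt.2 (hmax j hj0) (leadRank_lt_iff.2 (Or.inr ⟨heq.symm, ?_⟩))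
        have := (hl i hi).1.lt
        omega
      have hm' : (t i).2 ≠ (t j).2 := fun hm' => hj.1 (h.inj (Prod.ext hc hm'.symm))
      have := (hl j hj0).1.1
      rw [heq] at this
      exact (pow_dvd_pow _ (by omega)).trans this
  · rw [coef_sum]
    refine Finset.sum_eq_zero fun j _ => ?_
    by_cases hj0 : a j = 0
    · simp [hj0]
    · exact (hl j hj0).2 ν ((hle j hj0).trans_lt hν)

lemma IsLeadBasis.eq_zero_of_sum_eq_zero (hp : p.Prime)
    {M : Submodule (Zpr p r)[X] (PVec p r q)} {v : ι → PVec p r q} {d : ι → ℕ}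
    {t : ι → Fin q × ℕ} (h : IsLeadBasis M v d t) {a : ι → (Zpr p r)[X]}
    (ha : ∀ i, IsDigitPoly (a i)) (hs : ∑ i, a i • v i = 0) (i : ι) : a i = 0 := by
  by_contra hi
  obtain ⟨j, m, -, hl, -⟩ := h.lead_sum hp ha ⟨i, hi⟩
  exact hl.ne_zero hs

lemma IsLeadBasis.hasPPLM {n : ℕ} (hp : p.Prime)
    {M : Submodule (Zpr p r)[X] (PVec p r q)} {v : Fin n → PVec p r q} {d : Fin n → ℕ}
    {t : Fin n → Fin q × ℕ} (h : IsLeadBasis M v d t) : HasPPLM v := by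
  rintro f a hf ha rfl
  have hne : ∃ i, a i ≠ 0 := by
    by_contra! h0
    exact hf (by simp [h0])
  have hl : ∀ j, a j ≠ 0 → lm (a j • v j) = (toLex ((a j).natDegree + d j, (t j).1) :
      ℕ ×ₗ Fin q) :=
    fun j hj => ((h.lead j).smul ((ha j).isUnit_leadingCoeff hp hj)).lm_eq
  obtain ⟨i, m, hi, hlead, hle⟩ := h.lead_sum hp ha hne
  rw [hlead.lm_eq, ← hl i hi]
  apply le_antisymm
  · exact Finset.le_sup (f := fun i => lm (a i • v i)) (by simpa using hi)
  · refine Finset.sup_le fun j hj => ?_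
    have hj : a j ≠ 0 := by simpa using hj
    rw [hl i hi, hl j hj]
    exact WithBot.coe_le_coe.2 (hle j hj)

/-- Ordered by decreasing rank of the leads, the family is a `p`-basis. -/
lemma IsLeadBasis.exists_isPBasis {n : ℕ} (hp : p.Prime) (hr : 1 ≤ r)
    {M : Submodule (Zpr p r)[X] (PVec p r q)} {v : Fin n → PVec p r q} {d : Fin n → ℕ}
    {t : Fin n → Fin q × ℕ} (h : IsLeadBasis M v d t) :
    ∃ g : Equiv.Perm (Fin n), IsPBasis (fun i => v (g i)) M := by
  classical
  let ρ : Fin n → (ℕ ×ₗ Fin q) ×ₗ ℕ := fun i => leadRank r (toLex (d i, (t i).1)) (t i).2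
  let g : Equiv.Perm (Fin n) := Tuple.sort fun i => OrderDual.toDual (ρ i)
  have hg : ∀ i j, ρ (g j) < ρ (g i) → i < j := fun i j hij => by
    by_contra hle
    have := Tuple.monotone_sort (fun i => OrderDual.toDual (ρ i)) (not_lt.1 hle)
    exact absurd hij (not_lt.2 (OrderDual.toDual_le_toDual.1 this))
  have hb : IsLeadBasis M (fun i => v (g i)) (fun i => d (g i)) (fun i => t (g i)) :=
    { mem := fun i => h.mem _
      lead := fun i => h.lead _
      inj := h.inj.comp g.injective
      cover := fun f hf e c m hl => by
        obtain ⟨i, hi⟩ := h.cover f hf e c m hl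
        exact ⟨g.symm i, by simpa using hi⟩ }
  refine ⟨g, fun i => ?_, hb.pSpan_eq hp hr, fun a ha hs => hb.eq_zero_of_sum_eq_zero hp ha hs⟩
  by_cases h0 : p • v (g i) = 0
  · exact ⟨0, fun j n => by simpa using hp.pos, by simp [h0]⟩
  have hcoef : ∀ μ, coef (p • v (g i)) μ = (p : Zpr p r) * coef (v (g i)) μ := fun μ => by
    simp [coef]
  obtain ⟨μ, m, hl⟩ := exists_isLead h0
  have hlt : leadRank r μ m < ρ (g i) := by
    refine hl.leadRank_lt (fun ν hν => ?_) ?_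
    · rw [hcoef, (h.lead _).2 ν hν, mul_zero]
    · rw [hcoef, pow_succ']
      exact mul_dvd_mul_left _ (h.lead _).1.1
  obtain ⟨a, had, haf, har⟩ := hb.exists_combination hp hr _ (p • v (g i))
    (M.smul_of_tower_mem p (h.mem _)) μ m hl rfl
  -- A vector that is used ranks at most as high as `p • v (g i)`, hence below `v (g i)`, so it
  -- comes later in the ordering.
  have hzero : ∀ j, ¬ i < j → a j = 0 := fun j hj => by
    ext n
    by_contra hn
    exact hj (hg i j (((leadRank_mono_deg (Nat.le_add_left _ _) _ _).trans
      (har j n hn)).trans_lt hlt))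
  refine ⟨fun j => a j, fun j => had j, ?_⟩
  rw [haf]
  refine Eq.trans ?_ (Finset.sum_subtype (Finset.univ.filter fun j => i < j) (by simp)
    fun j => a j • v (g j))
  rw [Finset.sum_filter]
  refine Finset.sum_congr rfl fun j _ => ?_
  split_ifs with hj
  · rfl
  · rw [hzero j hj, zero_smul]

end LeadBasis

section Sequence

variable {p r : ℕ}

/-! ### The linear form attached to a sequence -/

/-- The polynomial `S_N x ^ N + ... + S_1 x`. -/
noncomputable def seqPoly (N : ℕ) (S : ℕ → Zpr p r) : (Zpr p r)[X] :=
  ∑ k ∈ Finset.Icc 1 N, C (S k) * X ^ k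

/-- The linear form `(f_1, f_2) ↦ f_1 + f_2 (S_N x ^ N + ... + S_1 x)`. -/
noncomputable def seqForm (N : ℕ) (S : ℕ → Zpr p r) : PVec p r 2 →ₗ[(Zpr p r)[X]] (Zpr p r)[X] :=
  LinearMap.proj 0 + seqPoly N S • LinearMap.proj 1

/-- The vectors on which the linear form of the sequence vanishes modulo `x ^ (k + 1)`. -/
noncomputable def annModule (N : ℕ) (S : ℕ → Zpr p r) (k : ℕ) :
    Submodule (Zpr p r)[X] (PVec p r 2) :=
  Submodule.comap (seqForm N S) (Ideal.span {X ^ (k + 1)})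

variable {N : ℕ} {S : ℕ → Zpr p r}

lemma seqForm_apply (f : PVec p r 2) : seqForm N S f = f 0 + seqPoly N S * f 1 := rfl

lemma mem_annModule {k : ℕ} {f : PVec p r 2} :
    f ∈ annModule N S k ↔ X ^ (k + 1) ∣ seqForm N S f :=
  Ideal.mem_span_singleton

lemma mem_annModule_succ {k : ℕ} {f : PVec p r 2} :
    f ∈ annModule N S (k + 1) ↔ f ∈ annModule N S k ∧ (seqForm N S f).coeff (k + 1) = 0 := by
  simp only [mem_annModule, X_pow_dvd_iff]
  constructor
  · exact fun h => ⟨fun d hd => h d (by omega), h _ (by omega)⟩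
  · rintro ⟨h, h'⟩ d hd
    rcases Nat.lt_succ_iff_lt_or_eq.1 hd with hd | rfl
    · exact h d hd
    · exact h'

lemma coeff_seqPoly (j : ℕ) :
    (seqPoly N S).coeff j = if 1 ≤ j ∧ j ≤ N then S j else 0 := by
  simp [seqPoly, finsetSum_coeff, coeff_C_mul, coeff_X_pow]

lemma shift_pow_apply (e : ℕ) (w : ℕ → Zpr p r) (n : ℕ) :
    (shift p r ^ e) w n = w (n + e) := by
  induction e generalizing w with
  | zero => rfl
  | succ e ih =>
    rw [pow_succ, Module.End.mul_apply, ih]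
    rfl

lemma aeval_shift_monomial (e : ℕ) (a : Zpr p r) (w : ℕ → Zpr p r) :
    aeval (shift p r) (monomial e a) w 0 = a * w e := by
  rw [aeval_monomial, Module.End.mul_apply, Module.algebraMap_end_apply, Pi.smul_apply,
    shift_pow_apply, zero_add, smul_eq_mul]

/-- At time `0`, `σ ^ e` reads from `b_k` the entry `1` in the first component exactly when `e = k`,
and `S (k - e)` in the second when `e < k`: this is the convolution computing the coefficient of `x
^ k`. -/
lemma rowAct_stepTraj {k : ℕ} (hk : k ≤ N) (f : PVec p r 2) :
    rowAct f (stepTraj N S k) 0 = (seqForm N S f).coeff k := by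
  have h0 : ∀ g : (Zpr p r)[X], aeval (shift p r) g (stepTraj N S k 0) 0 = g.coeff k := by
    intro g
    induction g using Polynomial.induction_on' with
    | add g g' hg hg' => simp [hg, hg']
    | monomial e a =>
      rw [aeval_shift_monomial, stepTraj, shift_pow_apply, coeff_monomial]
      have : e + (N - k) = N ↔ e = k := by omega
      simp [baseTraj, this]
  have h1 : ∀ g : (Zpr p r)[X],
      aeval (shift p r) g (stepTraj N S k 1) 0 = (seqPoly N S * g).coeff k := by
    intro g
    induction g using Polynomial.induction_on' with
    | add g g' hg hg' => simp [hg, hg', mul_add]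
    | monomial e a =>
      rw [aeval_shift_monomial, stepTraj, shift_pow_apply, ← C_mul_X_pow_eq_monomial,
        mul_left_comm, coeff_C_mul, coeff_mul_X_pow', coeff_seqPoly]
      congr 1
      have h2 : e + (N - k) < N ↔ e < k := by omega
      have h3 : N - (e + (N - k)) = k - e := by omega
      simp only [baseTraj, Matrix.cons_val_one, Matrix.cons_val_fin_one, h2, h3]
      split_ifs <;> first | rfl | omega
  rw [rowAct, Fin.sum_univ_two, Pi.add_apply, h0, h1, seqForm_apply, coeff_add]

lemma annModule_eq_seqModule : annModule N S N = seqModule N S := by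
  have hrange : Set.range (seqMatrix N S).row =
      {![X ^ (N + 1), 0], ![-(seqPoly N S), 1]} := by
    ext f
    simp only [Set.mem_range, Fin.exists_fin_two, Set.mem_insert_iff, Set.mem_singleton_iff]
    exact or_congr eq_comm eq_comm
  ext f
  rw [mem_annModule, seqModule, hrange, Submodule.mem_span_pair, seqForm_apply]
  constructor
  · rintro ⟨a, ha⟩
    refine ⟨a, f 1, ?_⟩
    ext1 c
    fin_cases c
    · simp only [Fin.zero_eta, Pi.add_apply, Pi.smul_apply, Matrix.cons_val_zero, smul_eq_mul]
      linear_combination -ha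
    · simp
  · rintro ⟨a, b, rfl⟩
    refine ⟨a, ?_⟩
    simp
    ring

lemma coeff_seqForm_C_smul (a : Zpr p r) (f : PVec p r 2) (n : ℕ) :
    (seqForm N S (C a • f)).coeff n = a * (seqForm N S f).coeff n := by
  rw [map_smul, smul_eq_mul, coeff_C_mul]

/-- The form of `f` starts in degree `k + 1` or later, and multiplication by `x` pushes it further:
proper shifts have no discrepancy. -/
lemma coeff_seqForm_X_pow_smul {k n : ℕ} {f : PVec p r 2} (hf : f ∈ annModule N S k)
    (hn : n ≠ 0) : (seqForm N S ((X ^ n : (Zpr p r)[X]) • f)).coeff (k + 1) = 0 := by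
  rw [map_smul, smul_eq_mul, coeff_X_pow_mul']
  split_ifs
  · exact X_pow_dvd_iff.1 (mem_annModule.1 hf) _ (by omega)
  · rfl

/-! ### Discrepancies and leads -/

/-- Every valuation of a discrepancy is attained by a row with no larger leading monomial. -/
lemma IsLeadBasis.exists_hasVal_coeff {ι : Type} (hp : p.Prime) (hr : 1 ≤ r) {k : ℕ}
    {v : ι → PVec p r 2} {d : ι → ℕ} {t : ι → Fin 2 × ℕ}
    (h : IsLeadBasis (annModule N S k) v d t) (μ : ℕ ×ₗ Fin 2) :
    ∀ w ∈ annModule N S k, ∀ m j, IsLead w μ m → HasVal ((seqForm N S w).coeff (k + 1)) j →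
      ∃ i, HasVal ((seqForm N S (v i)).coeff (k + 1)) j ∧ toLex (d i, (t i).1) ≤ μ := by
  have : Fact (1 < p ^ r) := ⟨Nat.one_lt_pow (by omega) hp.one_lt⟩
  induction μ using WellFoundedLT.induction with
  | ind μ ih =>
  intro w hw m j hl hj
  obtain ⟨⟨e, c⟩, rfl⟩ := toLex.surjective μ
  obtain ⟨i, hi, hd⟩ := h.cover w hw e c m hl
  -- The descent: it suffices to find a vector with a smaller lead whose discrepancy still has
  -- valuation `j`.
  have hlow : ∀ w' ∈ annModule N S k, (∀ ν, toLex (e, c) ≤ ν → coef w' ν = 0) →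
      HasVal ((seqForm N S w').coeff (k + 1)) j →
      ∃ i, HasVal ((seqForm N S (v i)).coeff (k + 1)) j ∧
        toLex (d i, (t i).1) ≤ (toLex (e, c) : ℕ ×ₗ Fin 2) := by
    intro w' hw' hv hj'
    have h0 : w' ≠ 0 := by
      rintro rfl
      exact hj'.ne_zero (by simp)
    obtain ⟨μ', m', hl'⟩ := exists_isLead h0
    have hlt := hl'.lt_of_vanish hv
    obtain ⟨i, hi, hle⟩ := ih μ' hlt w' hw' m' j hl' hj'
    exact ⟨i, hi, hle.trans hlt.le⟩
  have hs : IsLead ((X ^ (e - d i) : (Zpr p r)[X]) • v i) (toLex (e, c)) m := by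
    have hv := h.lead i
    rw [hi] at hv
    have := hv.smul (a := X ^ (e - d i)) (by simp)
    rwa [natDegree_X_pow, Nat.sub_add_cancel hd] at this
  obtain ⟨u, hu⟩ := hs.exists_cancel hp hl
  have hmem := (annModule N S k).sub_mem hw ((annModule N S k).smul_mem (C (u : Zpr p r))
    ((annModule N S k).smul_mem (X ^ (e - d i)) (h.mem i)))
  have hcoeff : (seqForm N S (w - C (u : Zpr p r) • (X ^ (e - d i) : (Zpr p r)[X]) • v i)).coeff
      (k + 1) = (seqForm N S w).coeff (k + 1) - u *
        (seqForm N S ((X ^ (e - d i) : (Zpr p r)[X]) • v i)).coeff (k + 1) := by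
    rw [map_sub, coeff_sub, coeff_seqForm_C_smul]
  by_cases hn : e - d i = 0
  · rw [hn, pow_zero, one_smul] at hu hmem hcoeff
    -- If the difference has discrepancy divisible by `p ^ (j + 1)`, then `v i` carries the
    -- valuation `j` itself. Otherwise the difference has valuation `j' ≤ j`, and multiplying by `p
    -- ^ (j - j')` restores `j`.
    by_cases hdvd : (p : Zpr p r) ^ (j + 1) ∣
        (seqForm N S (w - C (u : Zpr p r) • v i)).coeff (k + 1)
    · refine ⟨i, ?_, ?_⟩
      · rw [← hasVal_units_mul u]
        have := hj.add_dvd ((dvd_neg (α := Zpr p r)).2 hdvd)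
        rwa [hcoeff, neg_sub, add_sub_cancel] at this
      · rw [hi, show d i = e by omega]
    · have h0 : (seqForm N S (w - C (u : Zpr p r) • v i)).coeff (k + 1) ≠ 0 := fun h0 =>
        hdvd (by rw [h0]; exact dvd_zero _)
      obtain ⟨j', hj'⟩ := exists_hasVal h0
      have hle : j' ≤ j := by
        by_contra hlt
        exact hdvd ((pow_dvd_pow _ (by omega)).trans hj'.1)
      obtain ⟨u', hu'⟩ := hj'.exists_unit hp
      refine hlow _ ((annModule N S k).smul_mem (C ((p : Zpr p r) ^ (j - j'))) hmem)
        (fun ν hν => by rw [coef_C_smul, hu ν hν, mul_zero]) ?_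
      rw [coeff_seqForm_C_smul, hu', mul_left_comm, hasVal_units_mul, ← pow_add,
        Nat.sub_add_cancel hle]
      exact hasVal_pow hp hj.lt
  · refine hlow _ hmem hu ?_
    rwa [hcoeff, coeff_seqForm_X_pow_smul (h.mem i) hn, mul_zero, sub_zero]

/-- A row whose discrepancy has valuation `j` is not minimal for that when its leading monomial
occurs with a larger valuation of the leading coefficient among these rows. -/
lemma IsLeadBasis.exists_lt_of_same_lead {ι : Type} (hp : p.Prime) (hr : 1 ≤ r) {k : ℕ}
    {v : ι → PVec p r 2} {d : ι → ℕ} {t : ι → Fin 2 × ℕ}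
    (h : IsLeadBasis (annModule N S k) v d t) {w : PVec p r 2} (hw : w ∈ annModule N S k)
    {j m m' : ℕ} {μ : ℕ ×ₗ Fin 2} (hl : IsLead w μ m)
    (hj : (p : Zpr p r) ^ j ∣ (seqForm N S w).coeff (k + 1)) {w' : PVec p r 2}
    (hw' : w' ∈ annModule N S k) (hl' : IsLead w' μ m')
    (hj' : HasVal ((seqForm N S w').coeff (k + 1)) j) (hm : m < m') :
    ∃ i, HasVal ((seqForm N S (v i)).coeff (k + 1)) j ∧ toLex (d i, (t i).1) < μ := by
  have hs : IsLead (C ((p : Zpr p r) ^ (m' - m)) • w) μ m' := by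
    refine ⟨?_, fun ν hν => by rw [coef_C_smul, hl.2 ν hν, mul_zero]⟩
    obtain ⟨u, hu⟩ := hl.1.exists_unit hp
    rw [coef_C_smul, hu, mul_left_comm, hasVal_units_mul, ← pow_add,
      Nat.sub_add_cancel hm.le]
    exact hasVal_pow hp hl'.1.lt
  obtain ⟨u, hu⟩ := hs.exists_cancel hp hl'
  have hval : HasVal ((seqForm N S (w' - C (u : Zpr p r) •
      C ((p : Zpr p r) ^ (m' - m)) • w)).coeff (k + 1)) j := by
    rw [map_sub, coeff_sub, coeff_seqForm_C_smul, coeff_seqForm_C_smul, sub_eq_add_neg]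
    refine hj'.add_dvd (dvd_neg.2 (Dvd.dvd.mul_left ?_ _))
    -- As `m < m'`, the scaling contributes a factor `p` beyond the `p ^ j` in the discrepancy of
    -- `w`, so subtraction leaves the valuation `j` intact.
    rw [pow_succ']
    exact mul_dvd_mul (dvd_pow_self _ (by omega)) hj
  have h0 : w' - C (u : Zpr p r) • C ((p : Zpr p r) ^ (m' - m)) • w ≠ 0 := fun h0 =>
    hval.ne_zero (by rw [h0]; simp)
  obtain ⟨μ', n, hl0⟩ := exists_isLead h0
  obtain ⟨i, hi, hle⟩ := h.exists_hasVal_coeff hp hr μ' _ ((annModule N S k).sub_mem hw'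
    ((annModule N S k).smul_mem _ ((annModule N S k).smul_mem _ hw))) n j hl0 hval
  exact ⟨i, hi, hle.trans_lt (hl0.lt_of_vanish hu)⟩

end Sequence

/-! ### The update step -/

section Update

variable {p r : ℕ}

lemma single_mul_apply (a b i : Fin (2 * r)) (x : (Zpr p r)[X]) (R : State p r) (c : Fin 2) :
    (Matrix.single a b x * R) i c = if i = a then x * R b c else 0 := by
  split_ifs with h
  · subst h
    simp
  · exact Matrix.single_mul_apply_of_ne _ _ _ _ _ h _

lemma mem_levelSet {Δ : Fin (2 * r) → Zpr p r} {ℓ : Fin (2 * r) → Fin r} {j : Fin r}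
    {i : Fin (2 * r)} : i ∈ levelSet Δ ℓ j ↔ Δ i ≠ 0 ∧ ℓ i = j := by
  simp [levelSet]

/-- The level sets are disjoint and contain `up j` and `s j`, so only the summand `j = ℓ i` affects
row `i`. -/
lemma updateMatrix_mul_apply {Δ : Fin (2 * r) → Zpr p r} {θ : Fin (2 * r) → (Zpr p r)ˣ}
    {ℓ : Fin (2 * r) → Fin r} {s : Fin r → Fin (2 * r)} (hup : ∀ j, up j ∈ levelSet Δ ℓ j)
    (hs : ∀ j, s j ∈ levelSet Δ ℓ j) (R : State p r) (i : Fin (2 * r)) :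
    (updateMatrix Δ θ ℓ s * R) i =
      if Δ i = 0 then R i
      else if i = up (ℓ i) then
        (C (((θ (s (ℓ i)))⁻¹ : (Zpr p r)ˣ) : Zpr p r) * X : (Zpr p r)[X]) • R (s (ℓ i))
      else if i = s (ℓ i) then
        C ((-θ (s (ℓ i)) : (Zpr p r)ˣ) : Zpr p r) • R (up (ℓ i)) +
          C (θ (up (ℓ i)) : Zpr p r) • R (s (ℓ i))
      else C (θ (s (ℓ i)) : Zpr p r) • R i + C (-(θ i : Zpr p r)) • R (s (ℓ i)) := by
  simp only [mem_levelSet] at hup hs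
  ext1 c
  simp only [updateMatrix, Matrix.add_mul, Matrix.sum_mul, Matrix.add_apply, Matrix.sum_apply,
    single_mul_apply, Finset.sum_add_distrib (s := _ \ _), Finset.sum_ite_eq, Finset.mem_filter,
    Finset.mem_univ, true_and, Finset.mem_sdiff, Finset.mem_insert, Finset.mem_singleton,
    mem_levelSet, one_mul]
  by_cases h0 : Δ i = 0
  · rw [Finset.sum_eq_zero]
    · simp [h0]
    · intro j _
      have h1 : i ≠ up j := by
        rintro rfl
        exact (hup j).1 h0
      have h2 : i ≠ s j := by
        rintro rfl
        exact (hs j).1 h0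
      simp [h0, h1, h2]
  · rw [Finset.sum_eq_single (ℓ i)]
    · simp only [h0, if_false, zero_add, not_false_eq_true, ne_eq, true_and]
      by_cases h1 : i = up (ℓ i)
      -- When the pivot is `up j` itself, its two correction terms cancel and only the multiple by
      -- `x` remains.
      · by_cases h2 : i = s (ℓ i)
        · rw [← h1, ← h2]
          simp
        · simp [← h1, h2]
      · by_cases h2 : i = s (ℓ i)
        · rw [← h2]
          simp [h1]
        · simp [h1, h2]
          ring
    · intro j _ hj
      have h1 : i ≠ up j := by
        rintro rfl
        exact hj (hup j).2.symm
      have h2 : i ≠ s j := by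
        rintro rfl
        exact hj (hs j).2.symm
      simp [h1, h2, hj.symm]
    · simp

/-- The exchange of the types of the rows `up j` and `s j`. -/
def typeSwap (Δ : Fin (2 * r) → Zpr p r) (ℓ : Fin (2 * r) → Fin r) (s : Fin r → Fin (2 * r))
    (i : Fin (2 * r)) : Fin (2 * r) :=
  if Δ i = 0 then i else Equiv.swap (up (ℓ i)) (s (ℓ i)) i

lemma typeSwap_involutive {Δ : Fin (2 * r) → Zpr p r} {ℓ : Fin (2 * r) → Fin r}
    {s : Fin r → Fin (2 * r)} (hup : ∀ j, up j ∈ levelSet Δ ℓ j)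
    (hs : ∀ j, s j ∈ levelSet Δ ℓ j) : Function.Involutive (typeSwap Δ ℓ s) := by
  intro i
  simp only [mem_levelSet] at hup hs
  by_cases h0 : Δ i = 0
  · simp [typeSwap, h0]
  have h1 : Δ (Equiv.swap (up (ℓ i)) (s (ℓ i)) i) ≠ 0 ∧
      ℓ (Equiv.swap (up (ℓ i)) (s (ℓ i)) i) = ℓ i := by
    rw [Equiv.swap_apply_def]
    split_ifs
    · exact hs _
    · exact hup _
    · exact ⟨h0, rfl⟩
  simp only [typeSwap, h0, if_false, h1.1, h1.2, Equiv.swap_apply_self]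

/-! ### The invariant and its preservation -/

variable {N : ℕ} {S : ℕ → Zpr p r}

/-- The invariant of the algorithm. -/
def Invariant (N : ℕ) (S : ℕ → Zpr p r) (k : ℕ) (R : State p r) : Prop :=
  (∃ d t, IsLeadBasis (annModule N S k) R d t) ∧
    ∀ j : Fin r, (seqForm N S (R (up j))).coeff (k + 1) = (p : Zpr p r) ^ (j : ℕ)

lemma hasVal_level (hp : p.Prime) {Δ : Fin (2 * r) → Zpr p r} {θ : Fin (2 * r) → (Zpr p r)ˣ}
    {ℓ : Fin (2 * r) → Fin r}
    (hθ : ∀ i, Δ i ≠ 0 → Δ i = (θ i : Zpr p r) * (p : Zpr p r) ^ (ℓ i : ℕ)) {i : Fin (2 * r)}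
    (hi : Δ i ≠ 0) : HasVal (Δ i) (ℓ i) := by
  rw [hθ i hi, hasVal_units_mul]
  exact hasVal_pow hp (ℓ i).2

lemma mem_levelSet_iff_hasVal (hp : p.Prime) {Δ : Fin (2 * r) → Zpr p r}
    {θ : Fin (2 * r) → (Zpr p r)ˣ} {ℓ : Fin (2 * r) → Fin r}
    (hθ : ∀ i, Δ i ≠ 0 → Δ i = (θ i : Zpr p r) * (p : Zpr p r) ^ (ℓ i : ℕ)) {i : Fin (2 * r)}
    {j : Fin r} : i ∈ levelSet Δ ℓ j ↔ HasVal (Δ i) j := by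
  rw [mem_levelSet]
  constructor
  · rintro ⟨h, rfl⟩
    exact hasVal_level hp hθ h
  · exact fun h => ⟨h.ne_zero, Fin.ext ((hasVal_level hp hθ h.ne_zero).unique h)⟩

/-- The leading monomial of a pivot is strictly smaller than those of the other rows of the same
level. -/
lemma IsLeadBasis.pivot_lt (hp : p.Prime) (hr : 1 ≤ r) {k : ℕ} {R : State p r}
    {d : Fin (2 * r) → ℕ} {t : Fin (2 * r) → Fin 2 × ℕ}
    (h : IsLeadBasis (annModule N S k) R d t) {j : ℕ} {P : Finset (Fin (2 * r))}
    (hP : ∀ i, i ∈ P ↔ HasVal ((seqForm N S (R i)).coeff (k + 1)) j) {s i : Fin (2 * r)}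
    (hs : IsPivot R P s) (hi : i ∈ P) (hne : i ≠ s) :
    (toLex (d s, (t s).1) : ℕ ×ₗ Fin 2) < toLex (d i, (t i).1) := by
  have hmin : ∀ i ∈ P, (toLex (d s, (t s).1) : ℕ ×ₗ Fin 2) ≤ toLex (d i, (t i).1) := by
    intro i hi
    have := hs.2.1 i hi
    rwa [(h.lead s).lm_eq, (h.lead i).lm_eq, WithBot.coe_le_coe] at this
  refine lt_of_le_of_ne (hmin i hi) fun heq => ?_
  have hc : (t s).1 = (t i).1 := congrArg (fun x => (ofLex x).2) heq
  have hm : (t i).2 ≠ (t s).2 := fun hm => hne (h.inj (Prod.ext hc.symm hm))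
  have hls := h.lead s
  have hli := h.lead i
  rw [← heq] at hli
  have hvs := (hP s).1 hs.1
  have hvi := (hP i).1 hi
  -- Rows sharing a leading monomial have different valuations there; a tie would therefore produce
  -- a row of this level below the minimum.
  obtain ⟨l, hl, hlt⟩ : ∃ l, HasVal ((seqForm N S (R l)).coeff (k + 1)) j ∧
      toLex (d l, (t l).1) < (toLex (d s, (t s).1) : ℕ ×ₗ Fin 2) := by
    rcases lt_or_gt_of_ne hm with hm | hm
    · exact h.exists_lt_of_same_lead hp hr (h.mem i) hli hvi.1 (h.mem s) hls hvs hm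
    · exact h.exists_lt_of_same_lead hp hr (h.mem s) hls hvs.1 (h.mem i) hli hvi hm
  exact absurd (hmin l ((hP l).2 hl)) (not_le.2 hlt)

lemma Invariant.up_mem_levelSet (hp : p.Prime) {k : ℕ} {R : State p r}
    (h : Invariant N S k R) {θ : Fin (2 * r) → (Zpr p r)ˣ} {ℓ : Fin (2 * r) → Fin r}
    (hθ : ∀ i, (seqForm N S (R i)).coeff (k + 1) ≠ 0 →
      (seqForm N S (R i)).coeff (k + 1) = (θ i : Zpr p r) * (p : Zpr p r) ^ (ℓ i : ℕ))
    (j : Fin r) : up j ∈ levelSet (fun i => (seqForm N S (R i)).coeff (k + 1)) ℓ j := by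
  rw [mem_levelSet_iff_hasVal hp hθ, h.2 j]
  exact hasVal_pow hp j.2

/-- In each level the types of `up j` and the pivot are exchanged, and only the pivot's type gains
one degree. That jump is forced, since passing to the kernel of the discrepancy removes exactly the
pivot's lead in its old degree. -/
lemma Invariant.update (hp : p.Prime) (hr : 1 ≤ r) {k : ℕ} {R R' : State p r}
    (h : Invariant N S k R)
    (hu : IsUpdate (fun i => (seqForm N S (R i)).coeff (k + 1)) R R') :
    Invariant N S (k + 1) R' := by
  have : Fact (1 < p ^ r) := ⟨Nat.one_lt_pow (by omega) hp.one_lt⟩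
  obtain ⟨θ, ℓ, s, hθ, hpiv, rfl⟩ := hu
  have hup := h.up_mem_levelSet hp hθ
  obtain ⟨⟨d, t, hb⟩, -⟩ := h
  set Δ : Fin (2 * r) → Zpr p r := fun i => (seqForm N S (R i)).coeff (k + 1)
  have hs : ∀ j, s j ∈ levelSet Δ ℓ j := fun j => (hpiv j).1
  have hlt : ∀ i j, i ∈ levelSet Δ ℓ j → i ≠ s j →
      (toLex (d (s j), (t (s j)).1) : ℕ ×ₗ Fin 2) < toLex (d i, (t i).1) := fun i j hi hne =>
    hb.pivot_lt hp hr (fun i => mem_levelSet_iff_hasVal hp hθ) (hpiv j) hi hne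
  have hrow := updateMatrix_mul_apply (θ := θ) hup hs R
  have hΔup : ∀ j, Δ (up j) = θ (up j) * (p : Zpr p r) ^ (j : ℕ) := fun j => by
    have := mem_levelSet.1 (hup j)
    rw [hθ _ this.1, this.2]
  have hΔs : ∀ j, Δ (s j) = θ (s j) * (p : Zpr p r) ^ (j : ℕ) := fun j => by
    have := mem_levelSet.1 (hs j)
    rw [hθ _ this.1, this.2]
  have hrow_up : ∀ j, (updateMatrix Δ θ ℓ s * R) (up j) =
      (C (((θ (s j))⁻¹ : (Zpr p r)ˣ) : Zpr p r) * X : (Zpr p r)[X]) • R (s j) := fun j => by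
    have := mem_levelSet.1 (hup j)
    rw [hrow, if_neg this.1, this.2, if_pos rfl]
  constructor
  -- The extra degree sits at index `up j`, where `x` times the pivot is now stored.
  · refine ⟨fun i => d (typeSwap Δ ℓ s i) + if Δ i ≠ 0 ∧ i = up (ℓ i) then 1 else 0,
      fun i => t (typeSwap Δ ℓ s i), fun i => ?_, fun i => ?_,
      hb.inj.comp (typeSwap_involutive hup hs).injective, fun f hf e c m hl => ?_⟩
    · refine mem_annModule_succ.2 ⟨?_, ?_⟩
      · rw [hrow]
        split_ifs
        · exact hb.mem i
        · exact Submodule.smul_mem _ _ (hb.mem _)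
        · exact Submodule.add_mem _ (Submodule.smul_mem _ _ (hb.mem _))
            (Submodule.smul_mem _ _ (hb.mem _))
        · exact Submodule.add_mem _ (Submodule.smul_mem _ _ (hb.mem _))
            (Submodule.smul_mem _ _ (hb.mem _))
      · rw [hrow]
        split_ifs with h0 h1 h2
        · exact h0
        · rw [mul_smul, coeff_seqForm_C_smul, ← pow_one X,
            coeff_seqForm_X_pow_smul (hb.mem _) one_ne_zero, mul_zero]
        · rw [map_add, coeff_add, coeff_seqForm_C_smul, coeff_seqForm_C_smul]
          change _ * Δ _ + _ * Δ _ = 0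
          rw [hΔup, hΔs, Units.val_neg]
          ring
        · rw [map_add, coeff_add, coeff_seqForm_C_smul, coeff_seqForm_C_smul]
          change _ * Δ _ + _ * Δ _ = 0
          rw [hθ i h0, hΔs]
          ring
    · by_cases h0 : Δ i = 0
      · rw [hrow, if_pos h0]
        simpa [typeSwap, h0] using hb.lead i
      · have hi : i ∈ levelSet Δ ℓ (ℓ i) := mem_levelSet.2 ⟨h0, rfl⟩
        rw [hrow, if_neg h0]
        by_cases h1 : i = up (ℓ i)
        · have hsw : typeSwap Δ ℓ s i = s (ℓ i) := by
            rw [typeSwap, if_neg h0]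
            exact (congrArg (Equiv.swap _ _) h1).trans (Equiv.swap_apply_left _ _)
          simp only [if_pos h1,
            if_pos (show Δ i ≠ 0 ∧ i = up (ℓ i) from ⟨h0, h1⟩), hsw, add_comm _ 1]
          have hlc : IsUnit (C (((θ (s (ℓ i)))⁻¹ : (Zpr p r)ˣ) : Zpr p r) * X :
              (Zpr p r)[X]).leadingCoeff := by
            simp
          have := (hb.lead (s (ℓ i))).smul hlc
          rwa [natDegree_C_mul_X _ (Units.ne_zero _)] at this
        · simp only [if_neg h1,
            if_neg (show ¬ (Δ i ≠ 0 ∧ i = up (ℓ i)) from fun h => h1 h.2), add_zero]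
          by_cases h2 : i = s (ℓ i)
          · have hsw : typeSwap Δ ℓ s i = up (ℓ i) := by
              rw [typeSwap, if_neg h0]
              exact (congrArg (Equiv.swap _ _) h2).trans (Equiv.swap_apply_right _ _)
            rw [if_pos h2, hsw]
            exact (hb.lead _).add_of_lt (hb.lead _)
              (hlt _ _ (hup _) fun h => h1 (h2.trans h.symm)) _ _
          · rw [if_neg h2, typeSwap, if_neg h0, Equiv.swap_apply_of_ne_of_ne h1 h2]
            exact (hb.lead _).add_of_lt (hb.lead _) (hlt _ _ hi h2) _ _
    · rw [mem_annModule_succ] at hf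
      obtain ⟨i, hi, hd⟩ := hb.cover f hf.1 e c m hl
      refine ⟨typeSwap Δ ℓ s i, ?_, ?_⟩
      · rw [typeSwap_involutive hup hs, hi]
      · rw [typeSwap_involutive hup hs]
        split_ifs with hsw
        · set j := ℓ (typeSwap Δ ℓ s i)
          have his : i = s j := by
            have := typeSwap_involutive hup hs i
            rw [hsw.2, typeSwap, if_neg (mem_levelSet.1 (hup j)).1, (mem_levelSet.1 (hup j)).2,
              Equiv.swap_apply_left] at this
            exact this.symm
          -- Suppose the old degree still occurs. As `f` has zero discrepancy, cancelling its lead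
          -- with the pivot leaves a discrepancy of valuation `j` and a smaller lead, hence a row of
          -- level `j` below the pivot.
          by_contra hde
          have hde : e = d i := by omega
          subst hde
          have hl' := hb.lead i
          rw [hi] at hl'
          obtain ⟨u, hu⟩ := hl'.exists_cancel hp hl
          have hval : HasVal ((seqForm N S (f - C (u : Zpr p r) • R i)).coeff (k + 1)) j := by
            rw [map_sub, coeff_sub, coeff_seqForm_C_smul, hf.2, zero_sub, ← neg_mul,
              ← Units.val_neg, hasVal_units_mul, his]
            exact (mem_levelSet_iff_hasVal hp hθ).1 (hs j)
          have hne : f - C (u : Zpr p r) • R i ≠ 0 := fun h0 =>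
            hval.ne_zero (by rw [h0]; simp)
          obtain ⟨μ', m', hl0⟩ := exists_isLead hne
          obtain ⟨l, hlv, hle⟩ := hb.exists_hasVal_coeff hp hr μ' _
            (Submodule.sub_mem _ hf.1 (Submodule.smul_mem _ _ (hb.mem i))) m' j hl0 hval
          have hlt' := hle.trans_lt (hl0.lt_of_vanish hu)
          have hlP := (mem_levelSet_iff_hasVal hp hθ (i := l)).2 hlv
          rcases eq_or_ne l (s j) with rfl | hls
          · rw [← his, hi] at hlt'
            exact lt_irrefl _ hlt'
          · have := hlt l j hlP hls
            rw [← his, hi] at this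
            exact lt_asymm this hlt'
        · exact hd
  · intro j
    -- The factor `x` turns the old discrepancy `θ p ^ j` of the pivot into the next one, and `θ⁻¹`
    -- normalises it.
    rw [hrow_up, mul_smul, coeff_seqForm_C_smul, map_smul, smul_eq_mul, coeff_X_mul]
    change _ * Δ _ = _
    rw [hΔs, Units.inv_mul_cancel_left]

lemma Invariant.exists_isUpdate (hp : p.Prime) (hr : 1 ≤ r) {k : ℕ} {R : State p r}
    (h : Invariant N S k R) :
    ∃ R', IsUpdate (fun i => (seqForm N S (R i)).coeff (k + 1)) R R' := by
  have hex : ∀ i, ∃ (θ : (Zpr p r)ˣ) (ℓ : Fin r), (seqForm N S (R i)).coeff (k + 1) ≠ 0 →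
      (seqForm N S (R i)).coeff (k + 1) = (θ : Zpr p r) * (p : Zpr p r) ^ (ℓ : ℕ) := by
    intro i
    by_cases h0 : (seqForm N S (R i)).coeff (k + 1) = 0
    · exact ⟨1, ⟨0, hr⟩, fun h => absurd h0 h⟩
    · obtain ⟨m, hm⟩ := exists_hasVal h0
      obtain ⟨u, hu⟩ := hm.exists_unit hp
      exact ⟨u, ⟨m, hm.lt⟩, fun _ => hu⟩
  choose θ ℓ hθ using hex
  have hup := h.up_mem_levelSet hp hθ
  have hpiv : ∀ j, ∃ s, IsPivot R
      (levelSet (fun i => (seqForm N S (R i)).coeff (k + 1)) ℓ j) s := by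
    intro j
    -- Minimising the pair (leading monomial, reversed index) encodes the choice of the largest
    -- index among the minimal rows.
    obtain ⟨s, hs, hmin⟩ := Finset.exists_min_image _
      (fun i => (toLex (lm (R i), OrderDual.toDual i) :
        WithBot (ℕ ×ₗ Fin 2) ×ₗ (Fin (2 * r))ᵒᵈ)) ⟨_, hup j⟩
    refine ⟨s, hs, fun i hi => ?_, fun i hi heq => ?_⟩
    · rcases Prod.Lex.toLex_le_toLex.1 (hmin i hi) with h | h
      · exact h.le
      · exact h.1.le
    · rcases Prod.Lex.toLex_le_toLex.1 (hmin i hi) with h | h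
      · exact absurd heq h.ne'
      · exact h.2
  choose s hs using hpiv
  exact ⟨_, θ, ℓ, s, hθ, hs, rfl⟩

/-! ### The initial matrix and the run of the algorithm -/

lemma initState_apply_of_lt {i : Fin (2 * r)} (h : (i : ℕ) < r) :
    (initState p r) i = ![C ((p : Zpr p r) ^ (i : ℕ)) * X, 0] :=
  if_pos h

lemma initState_apply_of_not_lt {i : Fin (2 * r)} (h : ¬ (i : ℕ) < r) :
    (initState p r) i = ![0, C ((p : Zpr p r) ^ ((i : ℕ) - r))] :=
  if_neg h

lemma coeff_zero_seqPoly_mul (g : (Zpr p r)[X]) : (seqPoly N S * g).coeff 0 = 0 := by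
  rw [mul_coeff_zero, coeff_seqPoly]
  simp

/-- The form agrees with `f_1` modulo `x`, so `M_0` is given by `x ∣ f_1`: leads in the first
position have degree at least `1`, those in the second are unrestricted, and every valuation below
`r` is represented in both. -/
lemma invariant_initState (hp : p.Prime) : Invariant N S 0 (initState p r) := by
  constructor
  · refine ⟨fun i => if (i : ℕ) < r then 1 else 0,
      fun i => if (i : ℕ) < r then (0, (i : ℕ)) else (1, (i : ℕ) - r),
      fun i => ?_, fun i => ?_, fun i i' hii => ?_, fun f hf e c m hl => ?_⟩
    · rw [mem_annModule, zero_add, pow_one, X_dvd_iff, seqForm_apply, coeff_add,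
        coeff_zero_seqPoly_mul]
      by_cases h : (i : ℕ) < r
      · rw [initState_apply_of_lt h]
        simp
      · rw [initState_apply_of_not_lt h]
        simp
    · by_cases h : (i : ℕ) < r
      · rw [initState_apply_of_lt h]
        simp only [h, if_true]
        refine ⟨?_, fun ν hν => ?_⟩
        · change HasVal ((C ((p : Zpr p r) ^ (i : ℕ)) * X).coeff 1) i
          rw [coeff_C_mul, coeff_X_one, mul_one]
          exact hasVal_pow hp h
        · obtain ⟨⟨n, c⟩, rfl⟩ := toLex.surjective ν
          rw [toLex_lt_iff] at hν
          fin_cases c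
          · have : 1 ≠ n := by simp at hν; omega
            change (C ((p : Zpr p r) ^ (i : ℕ)) * X).coeff n = 0
            rw [coeff_C_mul, coeff_X, if_neg this, mul_zero]
          · simp [coef]
      · rw [initState_apply_of_not_lt h]
        simp only [h, if_false]
        refine ⟨?_, fun ν hν => ?_⟩
        · change HasVal ((C ((p : Zpr p r) ^ ((i : ℕ) - r))).coeff 0) _
          rw [coeff_C_zero]
          exact hasVal_pow hp (by omega)
        · obtain ⟨⟨n, c⟩, rfl⟩ := toLex.surjective ν
          rw [toLex_lt_iff] at hν
          fin_cases c
          · simp [coef]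
          · have : n ≠ 0 := by simp at hν; omega
            change (C ((p : Zpr p r) ^ ((i : ℕ) - r))).coeff n = 0
            rw [coeff_C, if_neg this]
    · ext
      split_ifs at hii <;> simp at hii <;> omega
    · have hm := hl.1.lt
      fin_cases c
      · refine ⟨⟨m, by omega⟩, by simp [hm], ?_⟩
        simp only [hm, if_true]
        rw [mem_annModule, zero_add, pow_one, X_dvd_iff, seqForm_apply, coeff_add,
          coeff_zero_seqPoly_mul, add_zero] at hf
        by_contra he
        have he : e = 0 := by omega
        subst he
        exact hl.1.ne_zero hf
      · exact ⟨⟨r + m, by omega⟩, by simp, by simp⟩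
  · intro j
    have hj : ((up j : Fin (2 * r)) : ℕ) = j := rfl
    rw [initState_apply_of_lt (by rw [hj]; exact j.2), seqForm_apply, hj]
    simp [-map_pow]

lemma discrepancy_eq {k : ℕ} (hk : k ≤ N) (R : State p r) :
    discrepancy N S k R = fun i => (seqForm N S (R i)).coeff k :=
  funext fun i => rowAct_stepTraj hk (R i)

lemma IsState.invariant (hp : p.Prime) (hr : 1 ≤ r) {k : ℕ} {R : State p r}
    (h : IsState N S k R) : Invariant N S k R := by
  induction h with
  | init => exact invariant_initState hp
  | step hk _ hu ih =>
    rw [discrepancy_eq hk] at hu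
    exact ih.update hp hr hu

end Update

end PRing

theorem mainTheorem3 (p : ℕ) (hp : p.Prime) (r : ℕ) (hr : 1 ≤ r) (N : ℕ)
    (S : ℕ → PRing.Zpr p r) :
    (∀ k < N, ∀ R : PRing.State p r, PRing.IsState N S k R →
      ∃ R' : PRing.State p r, PRing.IsUpdate (PRing.discrepancy N S (k + 1) R) R R') ∧
    ∀ R : PRing.State p r, PRing.IsOutput N S R →
      (∃ g : Equiv.Perm (Fin (2 * r)),
        PRing.IsPBasis (fun i => R (g i)) (PRing.seqModule N S)) ∧
      PRing.HasPPLM (fun i => R i) := by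
  refine ⟨fun k hk R hR => ?_, fun R hR => ?_⟩
  · rw [PRing.discrepancy_eq hk]
    exact (hR.invariant hp hr).exists_isUpdate hp hr
  · obtain ⟨⟨d, t, hb⟩, -⟩ := PRing.IsState.invariant hp hr hR
    rw [← PRing.annModule_eq_seqModule]
    exact ⟨hb.exists_isPBasis hp hr, hb.hasPPLM hp⟩
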